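/- Let $R$ be an associative ring with identity and $I$ a two-sided ideal of $R$; all modules are unital left $R$-modules. A submodule $N$ of a module $M$ is called PSD in $M$ if for every submodule $X$ of $M$ with $N+X=M$ there is a projective direct summand $S$ of $M$ with $S\subseteq N$ and $M=S\oplus X$. A module $M$ is PSD for $I$ if every submodule of $IM$ is PSD in $M$, and $R$ is a left PSD ring for $I$ if every finitely generated free left $R$-module is PSD for $I$. A projective $I$-cover of $M$ is a pair $(P,f)$ where $P$ is a projective module, $f:P\to M$ is an epimorphism, $\ker f\subseteq IP$, and $\ker f$ is PSD in $P$. The ring $R$ is $I$-semiperfect if for every left ideal $K$ of $R$ there is a decomposition $R=A\oplus B$ into left ideals such that $A$ is projective, $A\subseteq K$ and $K\cap B\subseteq I$. Consider the following conditions: 1. every finitely generated left $R$-module has a projective $I$-cover; 2. every factor module of ${}_RR$ has a projective $I$-cover; 3. for every countably generated left ideal $K$ of $R$, $R/K$ has a projective $I$-cover; 4. $R$ is $I$-semiperfect; 5. every simple left $R$-module has a projective $I$-cover; 6. every simple factor module of ${}_RR$ has a projective $I$-cover. Then $(1)\Rightarrow(2)\Rightarrow(3)\Rightarrow(4)$ and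 $(1)\Rightarrow(5)\Rightarrow(6)$. Moreover, $(4)\Rightarrow(1)$ if $R$ is a left PSD ring for $I$, and $(6)\Rightarrow(4)$ if $I$ is PSD in ${}_RR$. -/

import Mathlib

universe u v

namespace ICover

/-- `N` is PSD in `M`: whenever `N + X = M`, there is a projective direct summand `S` of `M`
contained in `N` with `M = S ⊕ X` (internal direct sum). -/
def IsPSD {R : Type u} [Ring R] {M : Type v} [AddCommGroup M] [Module R M]
    (N : Submodule R M) : Prop :=
  ∀ X : Submodule R M, N ⊔ X = ⊤ →
    ∃ S : Submodule R M, S ≤ N ∧ Module.Projective R S ∧ IsCompl S X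

/-- `M` is PSD for `I`: every submodule of `I M` is PSD in `M`. -/
def IsPSDFor {R : Type u} [Ring R] (I : Ideal R) (M : Type v) [AddCommGroup M] [Module R M] :
    Prop :=
  ∀ N : Submodule R M, N ≤ I • (⊤ : Submodule R M) → IsPSD N

/-- `R` is a left PSD ring for `I`: every finitely generated free left module is PSD for `I`. -/
def IsLeftPSDRing {R : Type u} [Ring R] (I : Ideal R) : Prop :=
  ∀ (F : Type u) [AddCommGroup F] [Module R F], Module.Finite R F → Module.Free R F →
    IsPSDFor I F

/-- `(P, f)` is a projective `I`-cover of `M`. -/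
structure IsProjectiveCover {R : Type u} [Ring R] (I : Ideal R) {P : Type u} {M : Type v}
    [AddCommGroup P] [Module R P] [AddCommGroup M] [Module R M] (f : P →ₗ[R] M) : Prop where
  projective : Module.Projective R P
  surjective : Function.Surjective f
  ker_le : LinearMap.ker f ≤ I • (⊤ : Submodule R P)
  ker_psd : IsPSD (LinearMap.ker f)

/-- `M` has a projective `I`-cover. -/
def HasProjectiveCover {R : Type u} [Ring R] (I : Ideal R) (M : Type u)
    [AddCommGroup M] [Module R M] : Prop :=
  ∃ (P : Type u) (_ : AddCommGroup P) (_ : Module R P) (f : P →ₗ[R] M), IsProjectiveCover I f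

/-- `M` is an `I`-semiperfect module: for every submodule `K` there is a decomposition
`M = A ⊕ B` with `A` projective, `A ⊆ K` and `K ∩ B ⊆ I M`. -/
def IsSemiperfectModule {R : Type u} [Ring R] (I : Ideal R) (M : Type v)
    [AddCommGroup M] [Module R M] : Prop :=
  ∀ K : Submodule R M, ∃ A B : Submodule R M,
    IsCompl A B ∧ Module.Projective R A ∧ A ≤ K ∧ K ⊓ B ≤ I • (⊤ : Submodule R M)

/-- `R` is an `I`-semiperfect ring: the left module `R` is `I`-semiperfect. -/
def IsSemiperfectRing {R : Type u} [Ring R] (I : Ideal R) : Prop :=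
  IsSemiperfectModule I R

/-- Every finitely generated left module has a projective `I`-cover. -/
def FiniteModulesHaveCovers {R : Type u} [Ring R] (I : Ideal R) : Prop :=
  ∀ (M : Type u) [AddCommGroup M] [Module R M], Module.Finite R M → HasProjectiveCover I M

/-- Every factor module of the left module `R` has a projective `I`-cover. -/
def FactorsHaveCovers {R : Type u} [Ring R] (I : Ideal R) : Prop :=
  ∀ K : Submodule R R, HasProjectiveCover I (R ⧸ K)

/-- `R / K` has a projective `I`-cover for every countably generated left ideal `K`. -/
def CountablyGeneratedFactorsHaveCovers {R : Type u} [Ring R] (I : Ideal R) : Prop :=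
  ∀ K : Submodule R R, (∃ s : Set R, s.Countable ∧ Submodule.span R s = K) →
    HasProjectiveCover I (R ⧸ K)

/-- Every simple left module has a projective `I`-cover. -/
def SimpleModulesHaveCovers {R : Type u} [Ring R] (I : Ideal R) : Prop :=
  ∀ (M : Type u) [AddCommGroup M] [Module R M], IsSimpleModule R M → HasProjectiveCover I M

/-- Every simple factor module of the left module `R` has a projective `I`-cover. -/
def SimpleFactorsHaveCovers {R : Type u} [Ring R] (I : Ideal R) : Prop :=
  ∀ K : Submodule R R, IsSimpleModule R (R ⧸ K) → HasProjectiveCover I (R ⧸ K)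

end ICover

/-!
`N` is PSD in `M` exactly when `M ⧸ X` is projective for every `X` with `N + X = M`
(`isPSD_iff_projective_quotient`). In this form PSD submodules clearly pass to smaller submodules
and to images under arbitrary linear maps, and finite sums of PSD submodules are PSD. Hence, if `I`
is PSD in `R`, then `I M` is PSD in every finitely generated module `M`: it is a finite sum of
images of `I`.

Covers and decompositions are related by lifting. If `P → M ⧸ K` is a cover and `M` is projective,
lifting the projection `M → M ⧸ K` to `P` splits `M` along `K`
(`HasProjectiveCover.exists_isCompl`); conversely, if `M = A ⊕ B` splits along `K` and `I M` is PSD,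
then `B → M ⧸ K` is a cover (`HasProjectiveCover.of_isCompl`). A cover of `M ⧸ N` with `N` PSD in
`M` extends to a cover of `M` (`HasProjectiveCover.of_quotient`).

Assume `I` is PSD in `R` and simple factors of `R` have covers. The resulting decompositions
of `R` show that every maximal submodule of `R ⧸ I` is a direct summand, so `R ⧸ I` is semisimple.
For finitely generated `M` the module `M ⧸ I M` is then a finite direct sum of simple modules, thus
it has a cover, and so does `M` because `I M` is PSD. Both implications with a PSD
hypothesis follow from this.

To pass from countably generated left ideals to all left ideals, it suffices to show that
every left ideal `K` lies in `K₀ + I` for a finitely generated `K₀ ≤ K`. Otherwise an infinite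
sequence of elements of `K` can be chosen, each outside the left ideal generated by its predecessors
together with `I`; the decomposition for the left ideal generated by the sequence contradicts this,
since its summand `A` is generated by one element (`exists_finset_span_le_le_sup`).
-/

namespace ICover

open LinearMap Submodule

/-! ### Projective direct summands and PSD submodules -/

section PSD

variable {R : Type u} [Ring R] {M : Type*} [AddCommGroup M] [Module R M]

theorem isCompl_range_ker_of_comp_eq_id {P Q : Type*} [AddCommGroup P] [Module R P]
    [AddCommGroup Q] [Module R Q] {f : P →ₗ[R] Q} {s : Q →ₗ[R] P} (h : f ∘ₗ s = LinearMap.id) :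
    IsCompl (range s) (ker f) := by
  have hs : ∀ y, f (s y) = y := fun y => LinearMap.congr_fun h y
  refine IsCompl.of_eq ?_ ?_
  · rw [eq_bot_iff]
    rintro _ ⟨⟨y, rfl⟩, hx⟩
    have hy : y = 0 := by rw [← hs y]; exact hx
    simp [hy]
  · rw [eq_top_iff]
    intro x _
    refine mem_sup.2 ⟨s (f x), ⟨_, rfl⟩, x - s (f x), ?_, by abel⟩
    simp [hs]

theorem projective_of_isCompl [Module.Projective R M] {A B : Submodule R M} (h : IsCompl A B) :
    Module.Projective R A :=
  .of_split A.subtype (A.projectionOnto B h) (by ext; simp)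

theorem projective_sup {A B : Submodule R M} (h : Disjoint A B) [Module.Projective R A]
    [Module.Projective R B] : Module.Projective R (A ⊔ B : Submodule R M) := by
  have hinj : Function.Injective (A.subtype.coprod B.subtype) := by
    rw [← ker_eq_bot, ker_coprod_of_disjoint_range _ _ (by simpa using h)]
    simp
  have e := LinearEquiv.ofInjective _ hinj
  rw [range_coprod, range_subtype, range_subtype] at e
  exact .of_equiv' e

/-- The PSD property without mention of summands: a complement `S` of `X` is isomorphic to `M ⧸ X`,
and if `M ⧸ X` is projective, then the surjection `N → M ⧸ X` splits, which places a complement of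
`X` inside `N`. -/
theorem isPSD_iff_projective_quotient {N : Submodule R M} :
    IsPSD N ↔ ∀ X : Submodule R M, N ⊔ X = ⊤ → Module.Projective R (M ⧸ X) := by
  refine forall₂_congr fun X hX => ⟨?_, fun h => ?_⟩
  · rintro ⟨S, -, hS, hSX⟩
    exact .of_equiv' (quotientEquivOfIsCompl X S hSX.symm).symm
  · have hsurj : range (X.mkQ ∘ₗ N.subtype) = ⊤ := by
      rw [range_comp, range_subtype, map_mkQ_eq_top, sup_comm, hX]
    obtain ⟨s, hs⟩ := LinearMap.exists_rightInverse_of_surjective _ hsurj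
    have hs' : X.mkQ ∘ₗ (N.subtype ∘ₗ s) = LinearMap.id := hs
    have hc := isCompl_range_ker_of_comp_eq_id hs'
    refine ⟨range (N.subtype ∘ₗ s), ?_, ?_, by simpa using hc⟩
    · rintro _ ⟨y, rfl⟩
      exact (s y).2
    · have hinj : Function.Injective (N.subtype ∘ₗ s) :=
        Function.LeftInverse.injective (g := X.mkQ) fun y => LinearMap.congr_fun hs' y
      exact .of_equiv' (LinearEquiv.ofInjective _ hinj)

theorem IsPSD.mono {N N' : Submodule R M} (h : IsPSD N) (hle : N' ≤ N) : IsPSD N' := by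
  rw [isPSD_iff_projective_quotient] at h ⊢
  exact fun X hX => h X (top_unique (hX ▸ sup_le_sup_right hle X))

/-- No surjectivity of `f` is needed: if `f N + X` is everything, then `M ⧸ f⁻¹ X` is isomorphic to
`M' ⧸ X`. -/
theorem IsPSD.map {M' : Type*} [AddCommGroup M'] [Module R M'] {N : Submodule R M}
    (h : IsPSD N) (f : M →ₗ[R] M') : IsPSD (N.map f) := by
  rw [isPSD_iff_projective_quotient] at h ⊢
  intro X hX
  have hdec : ∀ y, ∃ n ∈ N, y - f n ∈ X := fun y => by
    obtain ⟨_, ⟨n, hn, rfl⟩, x, hx, rfl⟩ := mem_sup.1 (hX ▸ mem_top : y ∈ N.map f ⊔ X)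
    exact ⟨n, hn, by simpa using hx⟩
  have hP := h (X.comap f) <| eq_top_iff.2 fun m _ => by
    obtain ⟨n, hn, hx⟩ := hdec (f m)
    exact mem_sup.2 ⟨n, hn, m - n, by simpa using hx, by abel⟩
  refine .of_equiv' (LinearEquiv.ofBijective ((X.comap f).mapQ X f le_rfl) ⟨?_, fun y => ?_⟩)
  · rw [← ker_eq_bot, mapQ, ker_liftQ, ker_comp, ker_mkQ, mkQ_map_self]
  · obtain ⟨y, rfl⟩ := X.mkQ_surjective y
    obtain ⟨n, -, hx⟩ := hdec y
    refine ⟨mkQ _ n, ?_⟩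
    rw [mkQ_apply, mapQ_apply, mkQ_apply, eq_comm, Submodule.Quotient.eq]
    exact hx

theorem isPSD_bot : IsPSD (⊥ : Submodule R M) := fun X hX =>
  ⟨⊥, le_rfl, inferInstance, by rw [bot_sup_eq] at hX; exact hX ▸ isCompl_bot_top⟩

/-- A complement `S ≤ N` of `N' + X` followed by a complement `T ≤ N'` of `S + X` gives the
complement `S ⊕ T` of `X`. -/
theorem IsPSD.sup {N N' : Submodule R M} (h : IsPSD N) (h' : IsPSD N') : IsPSD (N ⊔ N') := by
  intro X hX
  obtain ⟨S, hSN, hSp, hS⟩ := h (N' ⊔ X) (by rw [← sup_assoc, hX])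
  obtain ⟨T, hTN, hTp, hT⟩ := h' (S ⊔ X) (by rw [sup_left_comm, hS.sup_eq_top])
  have hSX : Disjoint S X := hS.disjoint.mono_right le_sup_right
  have hST : Disjoint S T := (hT.disjoint.mono_right le_sup_left).symm
  refine ⟨S ⊔ T, sup_le_sup hSN hTN, projective_sup hST, ?_, ?_⟩
  · rw [sup_comm]
    exact hSX.disjoint_sup_left_of_disjoint_sup_right hT.disjoint
  · rw [codisjoint_iff, sup_comm S, sup_assoc, hT.sup_eq_top]

theorem IsPSD.iSup {ι : Type*} [Finite ι] {N : ι → Submodule R M} (h : ∀ i, IsPSD (N i)) :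
    IsPSD (⨆ i, N i) := by
  cases nonempty_fintype ι
  rw [← Finset.sup_univ_eq_iSup]
  exact Finset.sup_induction isPSD_bot (fun _ h _ h' => h.sup h') fun i _ => h i

theorem map_smul_top_le {I : Ideal R} {M' : Type*} [AddCommGroup M'] [Module R M']
    (f : M →ₗ[R] M') : (I • (⊤ : Submodule R M)).map f ≤ I • (⊤ : Submodule R M') := by
  rw [map_smul'']
  exact smul_mono_right _ le_top

/-- If the family `x` generates `M`, then `I M` is the sum of the submodules `I x i`. -/
theorem iSup_map_smul_top_eq_of_span_eq_top (I : Ideal R) [I.IsTwoSided] {ι : Type*} {x : ι → M}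
    (hx : span R (Set.range x) = ⊤) :
    ⨆ i, Submodule.map (toSpanSingleton R M (x i)) I = I • (⊤ : Submodule R M) := by
  have hI : I = I • (⊤ : Submodule R R) := (Ideal.mul_top (I := I)).symm
  rw [← hx, span_range_eq_iSup, smul_iSup]
  refine iSup_congr fun i => ?_
  conv_lhs => rw [hI]
  rw [map_smul'', Submodule.map_top, range_toSpanSingleton]

theorem isPSD_smul_top_of_finite {I : Ideal R} [I.IsTwoSided] (hI : IsPSD (M := R) I)
    [Module.Finite R M] : IsPSD (I • (⊤ : Submodule R M)) := by
  obtain ⟨n, x, hx⟩ := Module.Finite.exists_fin (R := R) (M := M)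
  rw [← iSup_map_smul_top_eq_of_span_eq_top I hx]
  exact .iSup fun i => hI.map _

end PSD

/-! ### Projective covers relative to an ideal -/

section Covers

variable {R : Type u} [Ring R] {I : Ideal R} {M : Type u} [AddCommGroup M] [Module R M]

theorem HasProjectiveCover.of_equiv {M' : Type u} [AddCommGroup M'] [Module R M']
    (h : HasProjectiveCover I M) (e : M ≃ₗ[R] M') : HasProjectiveCover I M' := by
  obtain ⟨P, _, _, f, hf⟩ := h
  have hk : ker (e.toLinearMap ∘ₗ f) = ker f := by simp
  exact ⟨P, _, _, e.toLinearMap ∘ₗ f, hf.projective, e.surjective.comp hf.surjective,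
    hk ▸ hf.ker_le, hk ▸ hf.ker_psd⟩

theorem HasProjectiveCover.dfinsupp {ι : Type} [Finite ι] {M : ι → Type u}
    [∀ i, AddCommGroup (M i)] [∀ i, Module R (M i)] (h : ∀ i, HasProjectiveCover I (M i)) :
    HasProjectiveCover I (Π₀ i, M i) := by
  classical
  choose P _ _ f hf using h
  have := fun i => (hf i).projective
  have hk : ker (DFinsupp.mapRange.linearMap f) ≤
      ⨆ i, (ker (f i)).map (DFinsupp.lsingle i) := fun x hx => by
    have hx' : ∀ i, f i (x i) = 0 := fun i => by
      simpa using DFunLike.congr_fun (show DFinsupp.mapRange.linearMap f x = 0 from hx) i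
    rw [← DFinsupp.sum_single (f := x)]
    exact sum_mem fun i _ => mem_iSup_of_mem i ⟨x i, hx' i, rfl⟩
  refine ⟨Π₀ i, P i, _, _, DFinsupp.mapRange.linearMap f, inferInstance, ?_, ?_, ?_⟩
  · exact (DFinsupp.mapRange_surjective _ fun i => map_zero (f i)).2 fun i => (hf i).surjective
  · refine hk.trans (iSup_le fun i => (map_mono (hf i).ker_le).trans (map_smul_top_le _))
  · exact (IsPSD.iSup fun i => (hf i).ker_psd.map _).mono hk

/-- If `P → M ⧸ N` is a cover, lift it to `P → M`. Its image together with `N` is `M`, so there is a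
projective complement `S ≤ N` of the image, and `P × S → M` is a cover. -/
theorem HasProjectiveCover.of_quotient {N : Submodule R M} (hN : IsPSD N)
    (h : HasProjectiveCover I (M ⧸ N)) : HasProjectiveCover I M := by
  obtain ⟨P, _, _, f, hf⟩ := h
  have := hf.projective
  obtain ⟨g, hg⟩ := Module.projective_lifting_property N.mkQ f N.mkQ_surjective
  have hg' : ∀ p, N.mkQ (g p) = f p := fun p => LinearMap.congr_fun hg p
  have htop : N ⊔ range g = ⊤ := eq_top_iff.2 fun m _ => by
    obtain ⟨p, hp⟩ := hf.surjective (N.mkQ m)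
    refine mem_sup.2 ⟨m - g p, ?_, g p, ⟨p, rfl⟩, by abel⟩
    rw [← N.ker_mkQ, mem_ker, map_sub, hg', hp, sub_self]
  obtain ⟨S, hSN, hSp, hS⟩ := hN _ htop
  have hk : ker (g.coprod S.subtype) ≤ (ker f).map (inl R P S) := by
    rw [ker_coprod_of_disjoint_range _ _ (by simpa using hS.disjoint.symm), ker_subtype]
    rintro ⟨p, s⟩ ⟨hp, hs⟩
    refine ⟨p, ?_, by simp_all⟩
    have hp' : g p = 0 := hp
    simp [← hg', hp']
  refine ⟨P × S, _, _, g.coprod S.subtype, inferInstance, ?_, ?_, (hf.ker_psd.map _).mono hk⟩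
  · rw [← range_eq_top, range_coprod, range_subtype, sup_comm, hS.sup_eq_top]
  · exact hk.trans ((map_mono hf.ker_le).trans (map_smul_top_le _))

/-- If `f : P → M ⧸ K` is a cover, lift `M → M ⧸ K` to `g : M → P`. Since `ker f` is PSD, the range
of `g` is a direct summand of `P`, so `M → range g` splits; take `A = ker g` and `B` the range of a
splitting. -/
theorem HasProjectiveCover.exists_isCompl [Module.Projective R M] {K : Submodule R M}
    (h : HasProjectiveCover I (M ⧸ K)) : ∃ A B : Submodule R M,
      IsCompl A B ∧ Module.Projective R A ∧ A ≤ K ∧ K ⊓ B ≤ I • (⊤ : Submodule R M) := by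
  obtain ⟨P, _, _, f, hf⟩ := h
  have := hf.projective
  obtain ⟨g, hg⟩ := Module.projective_lifting_property f K.mkQ hf.surjective
  have hg' : ∀ m, f (g m) = K.mkQ m := fun m => LinearMap.congr_fun hg m
  have htop : ker f ⊔ range g = ⊤ := eq_top_iff.2 fun p _ => by
    obtain ⟨m, hm⟩ := K.mkQ_surjective (f p)
    refine mem_sup.2 ⟨p - g m, ?_, g m, ⟨m, rfl⟩, by abel⟩
    rw [mem_ker, map_sub, hg', hm, sub_self]
  obtain ⟨S, -, -, hS⟩ := hf.ker_psd _ htop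
  have := projective_of_isCompl hS.symm
  obtain ⟨s, hs⟩ := g.rangeRestrict.exists_rightInverse_of_surjective g.range_rangeRestrict
  have hc : IsCompl (ker g) (range s) := by
    simpa using (isCompl_range_ker_of_comp_eq_id hs).symm
  refine ⟨ker g, range s, hc, projective_of_isCompl hc, fun x hx => ?_, ?_⟩
  · rw [← K.ker_mkQ, mem_ker, ← hg', mem_ker.1 hx, map_zero]
  · rintro _ ⟨hxK, y, rfl⟩
    have hgy : g (s y) = y := congrArg Subtype.val (LinearMap.congr_fun hs y)
    have hy : (y : P) ∈ I • (⊤ : Submodule R P) := hf.ker_le <| by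
      rw [mem_ker, ← hgy, hg', ← mem_ker, K.ker_mkQ]
      exact hxK
    -- The map `P → range g → M` sends `y` to `s y`, and `I P` into `I M`.
    have := map_smul_top_le (s ∘ₗ (range g).projectionOnto S hS.symm) (mem_map_of_mem hy)
    simpa using this

/-- A partial converse of `HasProjectiveCover.exists_isCompl`: the cover is the restriction to `B`
of the projection `M → M ⧸ K`. -/
theorem HasProjectiveCover.of_isCompl [Module.Projective R M]
    (hI : IsPSD (I • (⊤ : Submodule R M))) {K A B : Submodule R M} (hAB : IsCompl A B)
    (hA : A ≤ K) (hB : K ⊓ B ≤ I • (⊤ : Submodule R M)) : HasProjectiveCover I (M ⧸ K) := by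
  have hk : ker (K.mkQ ∘ₗ B.subtype) ≤
      (I • (⊤ : Submodule R M)).map (B.projectionOnto A hAB.symm) := fun b hb => by
    have hbK : (b : M) ∈ K := by simpa using hb
    exact ⟨b, hB ⟨hbK, b.2⟩, by simp⟩
  refine ⟨B, _, _, K.mkQ ∘ₗ B.subtype, projective_of_isCompl hAB.symm, ?_,
    hk.trans (map_smul_top_le _), (hI.map _).mono hk⟩
  rw [← range_eq_top, range_comp, range_subtype, map_mkQ_eq_top]
  exact top_unique (hAB.sup_eq_top ▸ sup_le_sup_right hA B)

end Covers

/-! ### Semiperfect rings relative to an ideal -/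

section Rings

variable {R : Type u} [Ring R] {I : Ideal R}

/-- If the socle of `R ⧸ I` were proper, it would lie in a maximal submodule; but the cover of the
corresponding simple module yields a complement of that submodule, which is a simple submodule. -/
theorem isSemisimpleModule_quotient_of_simpleFactorsHaveCovers [I.IsTwoSided]
    (h : SimpleFactorsHaveCovers I) : IsSemisimpleModule R (R ⧸ (I : Submodule R R)) := by
  refine (isSemisimpleModule_iff R _).2 (complementedLattice_of_sSup_atoms_eq_top ?_)
  by_contra hne
  obtain ⟨m, hm, hle⟩ := (eq_top_or_exists_le_coatom _).resolve_left hne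
  have hm' : IsCoatom (m.comap (mkQ I)) := (isCoatom_comap_iff (mkQ_surjective I)).2 hm
  obtain ⟨A, B, hAB, -, hA, hB⟩ := (h _ (isSimpleModule_iff_isCoatom.2 hm')).exists_isCompl
  have hc : IsCompl m (B.map (mkQ I)) := by
    refine IsCompl.of_eq (eq_bot_iff.2 ?_) (eq_top_iff.2 ?_)
    · rintro _ ⟨hbm, b, hb, rfl⟩
      have : b ∈ I := by
        have := hB ⟨hbm, hb⟩
        rwa [show I • (⊤ : Submodule R R) = I from Ideal.mul_top (I := I)] at this
      exact (mem_bot R).2 ((Submodule.Quotient.mk_eq_zero I).2 this)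
    · rw [← range_mkQ I, ← Submodule.map_top, ← hAB.sup_eq_top, Submodule.map_sup]
      exact sup_le_sup_right (map_le_iff_le_comap.2 hA) _
  have hat : IsAtom (B.map (mkQ I)) := hc.symm.isAtom_iff_isCoatom.2 hm
  have hmem : B.map (mkQ I) ∈ {a | IsAtom a} := hat
  have hBm : B.map (mkQ I) ≤ m := (le_sSup hmem).trans hle
  exact hat.1 (hc.symm.disjoint.eq_bot_of_le hBm)

/-- `M ⧸ I M` is the sum of the images of `R ⧸ I` under the maps `r ↦ r x`. -/
theorem isSemisimpleModule_quotient_smul_top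
    (h : IsSemisimpleModule R (R ⧸ (I : Submodule R R))) (M : Type*) [AddCommGroup M]
    [Module R M] : IsSemisimpleModule R (M ⧸ I • (⊤ : Submodule R M)) := by
  set N := I • (⊤ : Submodule R M)
  let f : M → (R ⧸ (I : Submodule R R)) →ₗ[R] M ⧸ N := fun x =>
    liftQ I (N.mkQ ∘ₗ toSpanSingleton R M x) fun r hr =>
      (Submodule.Quotient.mk_eq_zero N).2 (smul_mem_smul hr mem_top)
  refine isSemisimpleModule_of_isSemisimpleModule_submodule' (p := fun x => range (f x))
    (fun x => IsSemisimpleModule.range (f x)) (eq_top_iff.2 fun y _ => ?_)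
  obtain ⟨x, rfl⟩ := N.mkQ_surjective y
  exact mem_iSup_of_mem x ⟨mkQ I 1, (liftQ_apply I _ 1).trans (by simp)⟩

theorem hasProjectiveCover_of_isSemisimpleModule (h : SimpleFactorsHaveCovers I) (M : Type u)
    [AddCommGroup M] [Module R M] [Module.Finite R M] [IsSemisimpleModule R M] :
    HasProjectiveCover I M := by
  obtain ⟨n, S, e, hS⟩ := IsSemisimpleModule.exists_linearEquiv_fin_dfinsupp R M
  refine (HasProjectiveCover.dfinsupp fun i => ?_).of_equiv e.symm
  obtain ⟨K, -, ⟨e⟩⟩ := isSimpleModule_iff_quot_maximal.1 (hS i)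
  exact (h K (.congr e.symm)).of_equiv e.symm

theorem finiteModulesHaveCovers_of_simpleFactorsHaveCovers [I.IsTwoSided] (hI : IsPSD (M := R) I)
    (h : SimpleFactorsHaveCovers I) : FiniteModulesHaveCovers I := by
  intro M _ _ _
  have := isSemisimpleModule_quotient_smul_top
    (isSemisimpleModule_quotient_of_simpleFactorsHaveCovers h) M
  exact .of_quotient (isPSD_smul_top_of_finite hI)
    (hasProjectiveCover_of_isSemisimpleModule h _)

theorem factorsHaveCovers_of_isSemiperfectRing [I.IsTwoSided] (hI : IsPSD (M := R) I)
    (h : IsSemiperfectRing I) : FactorsHaveCovers I := by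
  intro K
  obtain ⟨A, B, hAB, -, hA, hB⟩ := h K
  exact .of_isCompl (isPSD_smul_top_of_finite hI) hAB hA hB

/-- Every left ideal `K` is finitely generated modulo `I`, with generators taken from `K`. -/
theorem exists_finset_span_le_le_sup [I.IsTwoSided] (h : CountablyGeneratedFactorsHaveCovers I)
    (K : Submodule R R) : ∃ s : Finset R, span R s ≤ K ∧ K ≤ span R s ⊔ I := by
  classical
  by_contra! hcon
  have hx : ∀ s : Finset R, ∃ x, span R s ≤ K → x ∈ K ∧ x ∉ span R (s : Set R) ⊔ I := fun s => by
    by_cases hs : span R s ≤ K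
    · obtain ⟨x, hx⟩ := SetLike.not_le_iff_exists.1 (hcon s hs)
      exact ⟨x, fun _ => hx⟩
    · exact ⟨0, fun h => absurd h hs⟩
  choose x hx using hx
  -- Each `s (n + 1)` adds to `s n` an element of `K` outside `span R (s n) ⊔ I`.
  obtain ⟨s, hs0, hs1⟩ : ∃ s : ℕ → Finset R,
      s 0 = ∅ ∧ ∀ n, s (n + 1) = insert (x (s n)) (s n) :=
    ⟨fun n => Nat.rec ∅ (fun _ t => insert (x t) t) n, rfl, fun _ => rfl⟩
  have hsK : ∀ n : ℕ, span R (s n : Set R) ≤ K := fun n => by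
    induction n with
    | zero => simp [hs0]
    | succ n ih =>
      rw [hs1, Finset.coe_insert, span_insert]
      exact sup_le ((span_singleton_le_iff_mem _ _).2 (hx _ ih).1) ih
  have hmono : Monotone fun n => span R (s n : Set R) :=
    monotone_nat_of_le_succ fun n => span_mono (by simp [hs1])
  obtain ⟨A, B, hAB, -, hA, hB⟩ := (h (span R (⋃ n, (s n : Set R)))
    ⟨_, Set.countable_iUnion fun n => (s n).countable_toSet, rfl⟩).exists_isCompl
  rw [span_iUnion] at hA hB
  rw [show I • (⊤ : Submodule R R) = I from Ideal.mul_top (I := I)] at hB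
  -- The summand `A` is generated by the component `a` of `1`, hence lies in one `span R (s n)`.
  obtain ⟨a, ha, b, hb, hab⟩ := mem_sup.1 (hAB.sup_eq_top ▸ mem_top : (1 : R) ∈ A ⊔ B)
  obtain ⟨n, hn⟩ := (mem_iSup_of_directed _ hmono.directed_le).1 (hA ha)
  refine (hx _ (hsK n)).2 ?_
  have hxn : x (s n) ∈ ⨆ n, span R (s n : Set R) :=
    mem_iSup_of_mem (n + 1) (subset_span (by simp [hs1]))
  have hxa : x (s n) * a ∈ span R (s n : Set R) := smul_mem _ _ hn
  refine mem_sup.2 ⟨x (s n) * a, hxa, x (s n) * b, hB ⟨?_, B.smul_mem _ hb⟩, ?_⟩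
  · rw [eq_sub_of_add_eq' hab, mul_sub, mul_one]
    exact sub_mem hxn (mem_iSup_of_mem n hxa)
  · rw [← mul_add, hab, mul_one]

theorem isSemiperfectRing_of_countablyGeneratedFactorsHaveCovers [I.IsTwoSided]
    (h : CountablyGeneratedFactorsHaveCovers I) : IsSemiperfectRing I := by
  intro K
  have hI : I • (⊤ : Submodule R R) = I := Ideal.mul_top (I := I)
  obtain ⟨s, hsK, hKs⟩ := exists_finset_span_le_le_sup h K
  obtain ⟨A, B, hAB, hAp, hA, hB⟩ := (h _ ⟨s, s.countable_toSet, rfl⟩).exists_isCompl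
  refine ⟨A, B, hAB, hAp, hA.trans hsK, ?_⟩
  rintro x ⟨hxK, hxB⟩
  obtain ⟨y, hy, i, hi, rfl⟩ := mem_sup.1 (hKs hxK)
  let p := B.projection A hAB.symm
  -- `y - p y ∈ A` lies in the finitely generated ideal, so `p y` lies in it as well as in `B`.
  have hyI : p y ∈ I • (⊤ : Submodule R R) := hB ⟨?_, projection_apply_mem _ _⟩
  · have hpi := map_smul_top_le p (mem_map_of_mem (hI.symm ▸ hi : i ∈ I • (⊤ : Submodule R R)))
    have hx : p (y + i) = y + i := projection_apply_of_mem_left _ hxB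
    rw [← hx, map_add]
    exact add_mem hyI hpi
  · rw [← sub_sub_cancel y (p y)]
    exact sub_mem hy (hA (sub_projection_mem hAB.symm y))

end Rings

end ICover

open ICover in
theorem theorem2p13 {R : Type u} [Ring R] (I : Ideal R) [I.IsTwoSided] :
    (ICover.FiniteModulesHaveCovers I → ICover.FactorsHaveCovers I) ∧
    (ICover.FactorsHaveCovers I → ICover.CountablyGeneratedFactorsHaveCovers I) ∧
    (ICover.CountablyGeneratedFactorsHaveCovers I → ICover.IsSemiperfectRing I) ∧
    (ICover.FiniteModulesHaveCovers I → ICover.SimpleModulesHaveCovers I) ∧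
    (ICover.SimpleModulesHaveCovers I → ICover.SimpleFactorsHaveCovers I) ∧
    (ICover.IsLeftPSDRing I →
      ICover.IsSemiperfectRing I → ICover.FiniteModulesHaveCovers I) ∧
    (ICover.IsPSD (M := R) I →
      ICover.SimpleFactorsHaveCovers I → ICover.IsSemiperfectRing I) := by
  refine ⟨fun h K => h _ inferInstance, fun h K _ => h K,
    isSemiperfectRing_of_countablyGeneratedFactorsHaveCovers, fun h M _ _ _ => h M inferInstance,
    fun h K hK => h _ hK, fun hR h => ?_, fun hI h K => ?_⟩
  · have hI : IsPSD (M := R) I :=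
      hR R inferInstance inferInstance I (Ideal.mul_top (I := I)).ge
    exact finiteModulesHaveCovers_of_simpleFactorsHaveCovers hI fun K _ =>
      factorsHaveCovers_of_isSemiperfectRing hI h K
  · exact (finiteModulesHaveCovers_of_simpleFactorsHaveCovers hI h (R ⧸ K)
      inferInstance).exists_isCompl
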